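/- For a finite abelian group $Z$, an integer $s\ge 1$ and a function $f\colon Z\to\mathbb{R}$, let $$\|f\|_{U^s(Z)}=\Big(\frac{1}{|Z|^{s+1}}\sum_{x\in Z}\ \sum_{(h_1,\dots,h_s)\in Z^s}\ \prod_{\omega\in\{0,1\}^s} f(x+\omega_1h_1+\cdots+\omega_sh_s)\Big)^{1/2^s}$$ be the Gowers uniformity norm of $f$. Let $s\ge 2$ be an integer. Then there is a function $F_s$ of $\eta$, depending only on $s$, with $F_s(\eta)\to 0$ as $\eta\to 0^+$, such that the following holds. Let $Z$ be a finite abelian group, let $0<\eta\le 1$, and let $\nu\colon Z\to[0,\infty)$ satisfy $\|\nu-1\|_{U^{2s}(Z)}\le\eta$. Then for every $f\colon Z\to\mathbb{R}$ with $|f|\le\nu$ there exists $h\colon Z\to[-1,1]$ such that $$\|f-h\|_{U^s(Z)}\le F_s(\eta).$$ Moreover, if $f$ is nonnegative, then $h$ can be taken nonnegative. -/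

import Mathlib

open Filter Topology
open scoped BigOperators

/-- The Gowers uniformity norm `‖f‖_{U^s(Z)}` of a real-valued function `f` on a finite abelian
group `Z`: the `2^s`-th root of the average over `x ∈ Z` and `h ∈ Z^s` of the product, over all
`ω ∈ {0,1}^s`, of the values `f (x + ∑ i, ω i • h i)`. -/
noncomputable def gowersNorm {Z : Type*} [AddCommGroup Z] [Fintype Z] (s : ℕ) (f : Z → ℝ) : ℝ :=
  (𝔼 p : Z × (Fin s → Z), ∏ ω : Fin s → Fin 2, f (p.1 + ∑ i, (ω i : ℕ) • p.2 i))
    ^ ((1 : ℝ) / 2 ^ s)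

/-! The proof combines a dense model theorem with a densification argument. The `2^s`-th power of
the `U^s` norm of `g` is the correlation of `g` with its own dual function, so `h` should make `g =
f - h` nearly orthogonal to that dual function.

For dual functions of bounded families this is duality. They lie in a convex set `cutHull` that is
closed under products and whose members pair with `ν - 1` to at most its `U^{2s}` norm. By minimax
it is enough to beat one test function `φ` at a time. There the best bounded `h` wins up to the
pairing of `ν - 1` with a continuous function of `φ`, hence, by Weierstrass, with a polynomial in
`φ`, which is small (`exists_dense_model`).

But `f - h` is bounded only by `ν + 1`, so its dual function is not of this kind.
`exists_abs_expect_mul_cubeDual_le` exchanges unbounded entries for bounded ones, one vertex at a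
time: Cauchy–Schwarz removes the entry and leaves the square of a dual function, which is close to
`1`-bounded in mean square and may be truncated. The square of an `s`-dimensional dual function is a
`2s`-dimensional one (`cubeDual_glueFaces`), so the required moments follow from `U^{2s}` control
through the linear forms condition `abs_cubeForm_sub_one_le`, itself a consequence of
Gowers–Cauchy–Schwarz. -/

set_option linter.unusedSectionVars false

/-! ### Box forms and the Gowers–Cauchy–Schwarz inequality. -/

section BoxForm

variable {X : Type*} {κ : Type*} [Fintype κ] [DecidableEq κ]

/-- The vertex `ω` of the discrete box spanned by `z` and `y`. -/
def boxVertex (ω : κ → Fin 2) (z y : κ → X) : κ → X := fun i => if ω i = 0 then z i else y i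

/-- The multilinear form underlying the box norms. -/
noncomputable def boxForm [Fintype X] (F : (κ → Fin 2) → (κ → X) → ℝ) : ℝ :=
  𝔼 z : κ → X, 𝔼 y : κ → X, ∏ ω, F ω (boxVertex ω z y)

theorem boxVertex_update (ω : κ → Fin 2) (z y : κ → X) (i : κ) (a b : X) :
    boxVertex ω (Function.update z i a) (Function.update y i b) =
      Function.update (boxVertex ω z y) i (if ω i = 0 then a else b) := by
  funext j
  by_cases h : j = i
  · subst h; simp [boxVertex]
  · simp [boxVertex, h]

theorem update_boxVertex_update (ω : κ → Fin 2) (z y : κ → X) (i : κ) (c : Fin 2) (a : X) :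
    Function.update (boxVertex (Function.update ω i c) z y) i a =
      Function.update (boxVertex ω z y) i a := by
  funext j
  by_cases h : j = i
  · subst h; simp
  · simp [boxVertex, h]

theorem expect_update [Fintype X] (g : (κ → X) → ℝ) (i : κ) :
    𝔼 z : κ → X, g z = 𝔼 z : κ → X, 𝔼 a : X, g (Function.update z i a) := by
  rcases isEmpty_or_nonempty X with hX | hX
  · have : IsEmpty (κ → X) := ⟨fun z => hX.elim (z i)⟩
    simp
  have e : Function.Involutive
      (fun p : (κ → X) × X => (Function.update p.1 i p.2, p.1 i)) := by
    rintro ⟨z, a⟩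
    simp
  have h1 : 𝔼 p : (κ → X) × X, g (Function.update p.1 i p.2) = 𝔼 p : (κ → X) × X, g p.1 :=
    Fintype.expect_equiv e.toPerm _ _ fun p => rfl
  rw [← Finset.univ_product_univ, Finset.expect_product, Finset.expect_product] at h1
  simp only [Fintype.expect_const] at h1
  exact h1.symm

theorem prod_cube_split {M : Type*} [CommMonoid M] (H : (κ → Fin 2) → M) (i : κ) :
    ∏ ω, H ω = (∏ ω with ω i = 0, H ω) * ∏ ω with ω i = 0, H (Function.update ω i 1) := by
  rw [← Finset.prod_filter_mul_prod_filter_not Finset.univ (fun ω : κ → Fin 2 => ω i = 0)]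
  congr 1
  symm
  refine Finset.prod_nbij' (fun ω => Function.update ω i 1) (fun ω => Function.update ω i 0)
    ?_ ?_ ?_ ?_ ?_
  · simp
  · simp
  · intro ω hω
    simp only [Finset.mem_filter] at hω
    simp [← hω.2]
  · intro ω hω
    simp only [Finset.mem_filter, Finset.mem_univ, true_and] at hω
    have : ω i = 1 := by omega
    simp [← this]
  · simp

/-- On the face `ω i = 0` only `z i` occurs and on the opposite face only `y i`, so with the other
coordinates fixed the average over these two factors. The `i`-th coordinates of `p` are dummies. -/
theorem boxForm_eq_split [Fintype X] (F : (κ → Fin 2) → (κ → X) → ℝ) (i : κ) :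
    boxForm F = 𝔼 p : (κ → X) × (κ → X),
      (𝔼 a, ∏ ω with ω i = 0, F ω (Function.update (boxVertex ω p.1 p.2) i a)) *
        (𝔼 a, ∏ ω with ω i = 0,
          F (Function.update ω i 1) (Function.update (boxVertex ω p.1 p.2) i a)) := by
  rw [← Finset.univ_product_univ, Finset.expect_product, boxForm, expect_update _ i]
  refine Finset.expect_congr rfl fun z _ => ?_
  simp only [fun a : X => expect_update
    (fun y => ∏ ω, F ω (boxVertex ω (Function.update z i a) y)) i]
  rw [Finset.expect_comm]
  refine Finset.expect_congr rfl fun y _ => ?_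
  rw [Fintype.expect_mul_expect]
  refine Finset.expect_congr rfl fun a _ => Finset.expect_congr rfl fun b _ => ?_
  rw [prod_cube_split _ i]
  simp only [boxVertex_update, update_boxVertex_update]
  congr 1
  · refine Finset.prod_congr rfl fun ω hω => ?_
    simp only [Finset.mem_filter, Finset.mem_univ, true_and] at hω
    simp [hω]
  · simp

theorem boxForm_sq_le [Fintype X] (F : (κ → Fin 2) → (κ → X) → ℝ) (i : κ) :
    boxForm F ^ 2 ≤ boxForm (fun ω => F (Function.update ω i 0)) *
      boxForm (fun ω => F (Function.update ω i 1)) := by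
  rw [boxForm_eq_split F i, boxForm_eq_split (fun ω => F (Function.update ω i 0)) i,
    boxForm_eq_split (fun ω => F (Function.update ω i 1)) i]
  refine (Finset.expect_mul_sq_le_sq_mul_sq _ _ _).trans_eq ?_
  congr 1
  · refine Finset.expect_congr rfl fun p _ => ?_
    rw [sq]
    congr 1
    · refine Finset.expect_congr rfl fun a _ => Finset.prod_congr rfl fun ω hω => ?_
      simp only [Finset.mem_filter, Finset.mem_univ, true_and] at hω
      rw [← hω, Function.update_eq_self]
    · refine Finset.expect_congr rfl fun a _ => Finset.prod_congr rfl fun ω hω => ?_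
      simp only [Finset.mem_filter, Finset.mem_univ, true_and] at hω
      rw [Function.update_idem, ← hω, Function.update_eq_self]
  · refine Finset.expect_congr rfl fun p _ => ?_
    rw [sq]
    simp only [Function.update_idem]

theorem boxForm_const_nonneg [Fintype X] [Nonempty κ] (G : (κ → X) → ℝ) :
    0 ≤ boxForm (fun _ : κ → Fin 2 => G) := by
  obtain ⟨i⟩ := ‹Nonempty κ›
  rw [boxForm_eq_split _ i]
  exact Finset.expect_nonneg fun p _ => mul_self_nonneg _

/-- The product over a cube of a quantity that is controlled by the geometric mean over each edge
in direction `i`. -/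
theorem prod_le_prod_of_sq_le (A B : (κ → Fin 2) → ℝ) (hB : ∀ σ, 0 ≤ B σ)
    (i : κ) (h : ∀ σ, A σ ^ 2 ≤ B (Function.update σ i 0) * B (Function.update σ i 1)) :
    ∏ σ, A σ ≤ ∏ σ, B σ := by
  refine le_of_sq_le_sq ?_ (Finset.prod_nonneg fun σ _ => hB σ)
  rw [← Finset.prod_pow]
  calc ∏ σ, A σ ^ 2 ≤ ∏ σ, B (Function.update σ i 0) * B (Function.update σ i 1) :=
        Finset.prod_le_prod (fun σ _ => sq_nonneg _) fun σ _ => h σ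
    _ = (∏ σ, B σ) ^ 2 := by
        rw [prod_cube_split _ i, prod_cube_split B i]
        have h1 : ∏ σ with σ i = 0, B (Function.update σ i 0) * B (Function.update σ i 1) =
            ∏ σ with σ i = 0, B σ * B (Function.update σ i 1) := by
          refine Finset.prod_congr rfl fun σ hσ => ?_
          simp only [Finset.mem_filter, Finset.mem_univ, true_and] at hσ
          nth_rewrite 1 [← hσ]
          rw [Function.update_eq_self]
        simp only [Function.update_idem]
        rw [h1, Finset.prod_mul_distrib, sq]

/-- The Gowers–Cauchy–Schwarz inequality for box forms. -/
theorem abs_boxForm_pow_le [Fintype X] (F : (κ → Fin 2) → (κ → X) → ℝ) :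
    |boxForm F| ^ Fintype.card (κ → Fin 2) ≤ ∏ σ, |boxForm (fun _ : κ → Fin 2 => F σ)| := by
  -- `J` collects the directions already treated by Cauchy–Schwarz, in which the label is frozen to
  -- that of `σ`. Taking the product over all `σ`, with repetitions, keeps the exponent the same
  -- throughout the induction.
  have key : ∀ J : Finset κ, |boxForm F| ^ Fintype.card (κ → Fin 2) ≤
      ∏ σ : κ → Fin 2, |boxForm (fun ω => F (J.piecewise σ ω))| := by
    intro J
    induction J using Finset.induction_on with
    | empty => simp
    | insert i J hi ih =>
      refine ih.trans (prod_le_prod_of_sq_le _ _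
        (fun _ => abs_nonneg _) i fun σ => ?_)
      rw [sq_abs, ← abs_mul]
      refine le_trans (boxForm_sq_le _ i) (le_of_eq_of_le ?_ (le_abs_self _))
      have (c : Fin 2) : (fun ω => F (J.piecewise σ (Function.update ω i c))) =
          fun ω => F ((insert i J).piecewise (Function.update σ i c) ω) := by
        funext ω
        congr 1
        funext j
        by_cases hj : j = i
        · subst hj; simp [hi]
        · simp [Finset.piecewise, hj]
      rw [this, this]
  simpa using key Finset.univ

end BoxForm

/-! ### Gowers forms and dual functions on an abelian group. -/

section CubeForm

variable {Z : Type*} [AddCommGroup Z] {κ : Type*} [Fintype κ]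

/-- The displacement `∑ i, ω i • h i` of the vertex `ω` in the cube with edges `h`. -/
def cubePoint (ω : κ → Fin 2) (h : κ → Z) : Z := ∑ i, (ω i : ℕ) • h i

@[simp] theorem cubePoint_zero (h : κ → Z) : cubePoint 0 h = 0 := by simp [cubePoint]

variable [DecidableEq κ] [Fintype Z]

/-- The multilinear form underlying the Gowers norms. -/
noncomputable def cubeForm (f : (κ → Fin 2) → Z → ℝ) : ℝ :=
  𝔼 x : Z, 𝔼 h : κ → Z, ∏ ω, f ω (x + cubePoint ω h)

/-- The dual function of a family indexed by the vertices of a cube; the vertex `0` is left out. -/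
noncomputable def cubeDual (f : (κ → Fin 2) → Z → ℝ) (x : Z) : ℝ :=
  𝔼 h : κ → Z, ∏ ω ∈ Finset.univ.erase 0, f ω (x + cubePoint ω h)

theorem expect_comp_sum [Nonempty κ] (Ψ : Z → ℝ) :
    𝔼 z : κ → Z, Ψ (∑ i, z i) = 𝔼 x, Ψ x := by
  obtain ⟨i⟩ := ‹Nonempty κ›
  rw [expect_update _ i]
  have (z : κ → Z) : 𝔼 a, Ψ (∑ j, Function.update z i a j) = 𝔼 x, Ψ x := by
    refine Fintype.expect_equiv (Equiv.addRight (∑ j ∈ Finset.univ \ {i}, z j)) _ _ fun a => ?_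
    rw [Finset.sum_update_of_mem (Finset.mem_univ i)]
    rfl
  simp only [this, Fintype.expect_const]

theorem sum_boxVertex_add (ω : κ → Fin 2) (z h : κ → Z) :
    ∑ i, boxVertex ω z (z + h) i = ∑ i, z i + cubePoint ω h := by
  rw [cubePoint, ← Finset.sum_add_distrib]
  refine Finset.sum_congr rfl fun i _ => ?_
  have : ω i = 0 ∨ ω i = 1 := by omega
  rcases this with h0 | h0 <;> simp [boxVertex, h0]

/-- Substituting `y = z + h` turns the box into the cube with base point `∑ i, z i` and edges `h`;
for nonempty `κ` this base point is equidistributed. Cauchy–Schwarz for boxes thereby transfers to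
Gowers forms. -/
theorem boxForm_comp_sum [Nonempty κ] (f : (κ → Fin 2) → Z → ℝ) :
    boxForm (fun ω (z : κ → Z) => f ω (∑ i, z i)) = cubeForm f := by
  rw [cubeForm, ← expect_comp_sum (κ := κ)]
  refine Finset.expect_congr rfl fun z _ => ?_
  symm
  refine Fintype.expect_equiv (Equiv.addLeft z) _ _ fun h => ?_
  simp only [Equiv.coe_addLeft, sum_boxVertex_add]

theorem cubeForm_const_nonneg [Nonempty κ] (g : Z → ℝ) :
    0 ≤ cubeForm (fun _ : κ → Fin 2 => g) := by
  rw [← boxForm_comp_sum]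
  exact boxForm_const_nonneg _

/-- The Gowers–Cauchy–Schwarz inequality. -/
theorem abs_cubeForm_le [Nonempty κ] (f : (κ → Fin 2) → Z → ℝ) (c : (κ → Fin 2) → ℝ)
    (hc : ∀ ω, 0 ≤ c ω)
    (h : ∀ ω, cubeForm (fun _ : κ → Fin 2 => f ω) ≤ c ω ^ Fintype.card (κ → Fin 2)) :
    |cubeForm f| ≤ ∏ ω, c ω := by
  refine le_of_pow_le_pow_left₀ (n := Fintype.card (κ → Fin 2)) Fintype.card_ne_zero
    (Finset.prod_nonneg fun ω _ => hc ω) ?_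
  rw [← Finset.prod_pow, ← boxForm_comp_sum]
  refine (abs_boxForm_pow_le _).trans (Finset.prod_le_prod (fun _ _ => abs_nonneg _)
    fun ω _ => ?_)
  rw [boxForm_comp_sum fun _ => f ω, abs_of_nonneg (cubeForm_const_nonneg _)]
  exact h ω

theorem cubeForm_one : cubeForm (fun _ : κ → Fin 2 => (1 : Z → ℝ)) = 1 := by
  simp [cubeForm]

theorem cubeForm_const_zero : cubeForm (fun (_ : κ → Fin 2) (_ : Z) => (0 : ℝ)) = 0 := by
  simp [cubeForm]

theorem abs_cubeForm_le_cubeForm {f m : (κ → Fin 2) → Z → ℝ} (h : ∀ ω x, |f ω x| ≤ m ω x) :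
    |cubeForm f| ≤ cubeForm m := by
  refine (Finset.abs_expect_le _ _).trans (Finset.expect_le_expect fun x _ => ?_)
  refine (Finset.abs_expect_le _ _).trans (Finset.expect_le_expect fun y _ => ?_)
  rw [Finset.abs_prod]
  exact Finset.prod_le_prod (fun _ _ => abs_nonneg _) fun ω _ => h ω _

theorem abs_cubeDual_le_cubeDual {f m : (κ → Fin 2) → Z → ℝ} (h : ∀ ω x, |f ω x| ≤ m ω x)
    (x : Z) : |cubeDual f x| ≤ cubeDual m x := by
  refine (Finset.abs_expect_le _ _).trans (Finset.expect_le_expect fun y _ => ?_)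
  rw [Finset.abs_prod]
  exact Finset.prod_le_prod (fun _ _ => abs_nonneg _) fun ω _ => h ω _

theorem cubeForm_const_smul (c : ℝ) (g : Z → ℝ) :
    cubeForm (fun (_ : κ → Fin 2) x => c * g x) =
      c ^ Fintype.card (κ → Fin 2) * cubeForm (fun _ : κ → Fin 2 => g) := by
  simp only [cubeForm, Finset.prod_mul_distrib, Finset.prod_const, Finset.mul_expect,
    Finset.card_univ]

theorem cubeForm_eq_expect_cubeDual (f : (κ → Fin 2) → Z → ℝ) :
    cubeForm f = 𝔼 x, f 0 x * cubeDual f x := by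
  refine Finset.expect_congr rfl fun x _ => ?_
  rw [cubeDual, Finset.mul_expect]
  refine Finset.expect_congr rfl fun h _ => ?_
  rw [← Finset.mul_prod_erase _ _ (Finset.mem_univ 0)]
  simp

theorem cubeDual_update_zero (f : (κ → Fin 2) → Z → ℝ) (w : Z → ℝ) :
    cubeDual (Function.update f 0 w) = cubeDual f := by
  funext x
  refine Finset.expect_congr rfl fun h _ => Finset.prod_congr rfl fun ω hω => ?_
  rw [Function.update_of_ne (Finset.ne_of_mem_erase hω)]

theorem cubeForm_update_zero (f : (κ → Fin 2) → Z → ℝ) (w : Z → ℝ) :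
    cubeForm (Function.update f 0 w) = 𝔼 x, w x * cubeDual f x := by
  rw [cubeForm_eq_expect_cubeDual, cubeDual_update_zero, Function.update_self]

theorem cubeDual_one : cubeDual (fun _ : κ → Fin 2 => (1 : Z → ℝ)) = 1 := by
  funext x
  simp [cubeDual]

/-- Any vertex of the cube can be taken as its base point. -/
theorem cubeForm_add_left (f : (κ → Fin 2) → Z → ℝ) (ω₀ : κ → Fin 2) :
    cubeForm (fun τ => f (ω₀ + τ)) = cubeForm f := by
  -- Moving the base point to the vertex `ω₀` reverses exactly the edges with `ω₀ i = 1`. This is an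
  -- involution on cubes, and it relabels vertices by addition of `ω₀` modulo 2.
  let r : (κ → Z) → κ → Z := fun h i => if ω₀ i = 0 then h i else -h i
  have hr (h : κ → Z) (i : κ) : r h i = if ω₀ i = 0 then h i else -h i := rfl
  have hrr (h) : r (r h) = h := by
    funext i
    by_cases hi : ω₀ i = 0 <;> simp [hr, hi]
  have hadd (τ h) : cubePoint ω₀ h + cubePoint τ (r h) = cubePoint (ω₀ + τ) h := by
    simp only [cubePoint, ← Finset.sum_add_distrib, Pi.add_apply, hr]
    refine Finset.sum_congr rfl fun i _ => ?_
    generalize ω₀ i = a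
    generalize τ i = b
    fin_cases a <;> fin_cases b <;> simp
  have e : Function.Involutive
      (fun p : Z × (κ → Z) => (p.1 + cubePoint ω₀ p.2, r p.2)) := by
    rintro ⟨x, h⟩
    ext1
    · have : cubePoint ω₀ h + cubePoint ω₀ (r h) = 0 := by
        rw [hadd]
        have : ω₀ + ω₀ = 0 := by
          funext i
          simp only [Pi.add_apply, Pi.zero_apply]
          omega
        simp [this]
      simp [add_assoc, this]
    · exact hrr h
  simp only [cubeForm]
  rw [← Finset.expect_product', ← Finset.expect_product']
  simp only [Finset.univ_product_univ]
  symm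
  refine Fintype.expect_equiv e.toPerm _ _ fun p => ?_
  rw [← Equiv.prod_comp (Equiv.addLeft ω₀)]
  simp [add_assoc, hadd]

/-! ### Products of dual functions and the linear forms condition. -/

variable {ι : Type*} [Fintype ι] [DecidableEq ι]

/-- The family on the cube over `ι ⊕ ι` that carries `f` and `f'` on two faces meeting at `0`. -/
noncomputable def glueFaces (f f' : (ι → Fin 2) → Z → ℝ) (ω : ι ⊕ ι → Fin 2) : Z → ℝ :=
  if (fun i => ω (Sum.inl i)) = 0 then f' (fun i => ω (Sum.inr i))
  else if (fun i => ω (Sum.inr i)) = 0 then f (fun i => ω (Sum.inl i)) else 1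

theorem prod_glue {A : Type*} {B : Type*} [Fintype A] [Fintype B] [DecidableEq A] [DecidableEq B]
    (a₀ : A) (b₀ : B) (a : A → ℝ) (b : B → ℝ) :
    ∏ p ∈ Finset.univ.erase (a₀, b₀),
      (if p.1 = a₀ then b p.2 else if p.2 = b₀ then a p.1 else 1) =
    (∏ i ∈ Finset.univ.erase a₀, a i) * ∏ j ∈ Finset.univ.erase b₀, b j := by
  have h1 : ∏ p ∈ Finset.univ.erase (a₀, b₀),
      (if p.1 = a₀ then b p.2 else if p.2 = b₀ then a p.1 else 1) =
      ∏ p : A × B, (if p.1 = a₀ then (if p.2 = b₀ then 1 else b p.2)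
        else if p.2 = b₀ then a p.1 else 1) := by
    rw [← Finset.mul_prod_erase Finset.univ _ (Finset.mem_univ (a₀, b₀))]
    simp only [if_true, one_mul]
    refine Finset.prod_congr rfl fun p hp => ?_
    have := Finset.ne_of_mem_erase hp
    by_cases h : p.1 = a₀
    · have : p.2 ≠ b₀ := fun h' => this (Prod.ext h h')
      simp [h, this]
    · simp [h]
  have h2 : ∏ j ∈ Finset.univ.erase b₀, b j = ∏ j, if j = b₀ then 1 else b j := by
    rw [← Finset.mul_prod_erase Finset.univ _ (Finset.mem_univ b₀)]
    simp only [if_true, one_mul]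
    exact Finset.prod_congr rfl fun p hp => by simp [Finset.ne_of_mem_erase hp]
  rw [h1, h2, Fintype.prod_prod_type, ← Finset.mul_prod_erase Finset.univ _ (Finset.mem_univ a₀),
    mul_comm]
  congr 1
  · refine Finset.prod_congr rfl fun i hi => ?_
    simp [Finset.ne_of_mem_erase hi]
  · simp

theorem cubePoint_sum (ω : ι ⊕ ι → Fin 2) (h : ι ⊕ ι → Z) :
    cubePoint ω h = cubePoint (fun i => ω (Sum.inl i)) (fun i => h (Sum.inl i)) +
      cubePoint (fun i => ω (Sum.inr i)) (fun i => h (Sum.inr i)) := by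
  simp [cubePoint]

/-- The two dual functions use independent edge vectors, so together they form a cube of twice the
dimension, with entry `1` off the two faces. This is where the passage from `s` to `2s` arises. -/
theorem cubeDual_glueFaces (f f' : (ι → Fin 2) → Z → ℝ) (x : Z) :
    cubeDual (glueFaces f f') x = cubeDual f x * cubeDual f' x := by
  rw [cubeDual, cubeDual, cubeDual, Fintype.expect_mul_expect, ← Finset.expect_product']
  simp only [Finset.univ_product_univ]
  refine Fintype.expect_equiv (Equiv.sumArrowEquivProdArrow ι ι Z) _ _ fun h => ?_
  rw [← prod_glue]
  refine Finset.prod_equiv (Equiv.sumArrowEquivProdArrow ι ι (Fin 2)) ?_ ?_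
  · intro ω
    simp only [Finset.mem_erase, Finset.mem_univ, and_true, ne_eq, not_iff_not]
    constructor
    · rintro rfl
      rfl
    · intro h
      exact (Equiv.sumArrowEquivProdArrow ι ι (Fin 2)).injective (h.trans rfl)
  · intro ω _
    rw [cubePoint_sum]
    change glueFaces f f' ω _ = if (fun i => ω (Sum.inl i)) = 0
      then f' (fun i => ω (Sum.inr i)) (x + cubePoint _ fun i => h (Sum.inr i))
      else if (fun i => ω (Sum.inr i)) = 0
      then f (fun i => ω (Sum.inl i)) (x + cubePoint _ fun i => h (Sum.inl i)) else 1
    unfold glueFaces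
    by_cases h1 : (fun i => ω (Sum.inl i)) = 0
    · simp [h1]
      rfl
    · by_cases h2 : (fun i => ω (Sum.inr i)) = 0
      · simp [h1, h2]
        rfl
      · simp [h1, h2]

/-- The *linear forms condition*: it follows from a bound on a single Gowers norm. -/
theorem abs_cubeForm_sub_one_le [Nonempty κ] {ν : Z → ℝ} {η : ℝ} (hη : 0 ≤ η) (hη1 : η ≤ 1)
    (hν : cubeForm (fun (_ : κ → Fin 2) x => ν x - 1) ≤ η ^ Fintype.card (κ → Fin 2))
    {m : (κ → Fin 2) → Z → ℝ} (hm : ∀ ω, m ω = ν ∨ m ω = 1) :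
    |cubeForm m - 1| ≤ 2 ^ Fintype.card (κ → Fin 2) * η := by
  -- Expand each entry as `(m ω - 1) + 1`. The empty set gives the main term `1`; any other `t`
  -- gives at most `η ^ #t ≤ η` by Gowers–Cauchy–Schwarz, since `m ω - 1` is either `ν - 1` or `0`.
  have hexp : cubeForm m = ∑ t : Finset (κ → Fin 2),
      cubeForm (fun ω => if ω ∈ t then fun x => m ω x - 1 else 1) := by
    simp only [cubeForm]
    rw [← Finset.expect_sum_comm]
    refine Finset.expect_congr rfl fun x _ => ?_
    rw [← Finset.expect_sum_comm]
    refine Finset.expect_congr rfl fun h _ => ?_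
    have := Finset.prod_add_one (s := Finset.univ)
      (f := fun ω : κ → Fin 2 => m ω (x + cubePoint ω h) - 1)
    simp only [sub_add_cancel, Finset.powerset_univ] at this
    rw [this]
    refine Finset.sum_congr rfl fun t _ => ?_
    rw [← Finset.prod_subset (Finset.subset_univ t)]
    · exact Finset.prod_congr rfl fun ω hω => by simp [hω]
    · intro ω _ hω
      simp [hω]
  have hempty : cubeForm (fun ω : κ → Fin 2 =>
      if ω ∈ (∅ : Finset (κ → Fin 2)) then fun x => m ω x - 1 else 1) = 1 := by
    simpa using cubeForm_one (κ := κ) (Z := Z)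
  rw [hexp, ← Finset.add_sum_erase _ _ (Finset.mem_univ ∅), hempty, add_sub_cancel_left]
  refine (Finset.abs_sum_le_sum_abs _ _).trans ((Finset.sum_le_card_nsmul _ _ η ?_).trans ?_)
  · intro t ht
    have hne : t.Nonempty := Finset.nonempty_iff_ne_empty.2 (Finset.ne_of_mem_erase ht)
    refine (abs_cubeForm_le _ (fun ω => if ω ∈ t then η else 1) ?_ ?_).trans ?_
    · intro ω
      split_ifs <;> positivity
    · intro ω
      by_cases hω : ω ∈ t
      · simp only [hω, if_true]
        rcases hm ω with h | h
        · simpa [h] using hν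
        · simp only [h, Pi.one_apply, sub_self, cubeForm_const_zero]
          positivity
      · simpa [hω] using (cubeForm_one (κ := κ) (Z := Z)).le
    · rw [Finset.prod_ite_mem, Finset.univ_inter, Finset.prod_const]
      exact pow_le_of_le_one hη hη1 hne.card_pos.ne'
  · rw [nsmul_eq_mul]
    refine mul_le_mul_of_nonneg_right ?_ hη
    have : (Finset.univ.erase (∅ : Finset (κ → Fin 2))).card ≤ 2 ^ Fintype.card (κ → Fin 2) := by
      refine (Finset.card_erase_le).trans ?_
      simp
    exact_mod_cast this

end CubeForm

theorem isLinearMap_expect_mul {Z : Type*} [Fintype Z] (g : Z → ℝ) :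
    IsLinearMap ℝ (fun φ : Z → ℝ => 𝔼 x, g x * φ x) where
  map_add φ ψ := by simp [mul_add, Finset.expect_add_distrib]
  map_smul c φ := by
    simp only [Pi.smul_apply, smul_eq_mul, Finset.mul_expect]
    exact Finset.expect_congr rfl fun x _ => by ring

theorem continuous_expect_mul {Z : Type*} [Fintype Z] (g : Z → ℝ) :
    Continuous (fun φ : Z → ℝ => 𝔼 x, g x * φ x) := by
  simp only [Fintype.expect_eq_sum_div_card]
  fun_prop

theorem expect_mem_of_convex {Z : Type*} {C : Set (Z → ℝ)} (hC : Convex ℝ C) {α : Type*} [Fintype α]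
    [Nonempty α] (f : α → Z → ℝ) (hf : ∀ a, f a ∈ C) : (fun x => 𝔼 a, f a x) ∈ C := by
  have h := hC.sum_mem (t := Finset.univ) (w := fun _ : α => (Fintype.card α : ℝ)⁻¹) (z := f)
    (fun _ _ => by positivity) (by simp) (fun a _ => hf a)
  convert h using 1
  funext x
  simp [Fintype.expect_eq_sum_div_card, Finset.sum_apply, div_eq_inv_mul, Finset.mul_sum]

/-! ### Cut functions: a multiplicatively closed convex class of tests. -/

section CutFunctions

variable {Z : Type*} [AddCommGroup Z] [Fintype Z] {κ : Type*} [Fintype κ] [DecidableEq κ]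

/-- A family of functions on `Z^κ`, bounded by `1`, the `i`-th of which ignores coordinate `i`. -/
def IsCutFamily (u : κ → (κ → Z) → ℝ) : Prop :=
  (∀ i z, |u i z| ≤ 1) ∧ ∀ i z a, u i (Function.update z i a) = u i z

/-- The average of `∏ i, u i z` over the `z` with `∑ i, z i = x`. -/
noncomputable def cutFun (i₀ : κ) (u : κ → (κ → Z) → ℝ) (x : Z) : ℝ :=
  𝔼 w : κ → Z, ∏ i, u i (w + Pi.single i₀ (x - ∑ j, w j))

/-- The closed convex hull of the functions `cutFun i₀ u`. -/
noncomputable def cutHull (Z : Type*) [AddCommGroup Z] [Fintype Z] (i₀ : κ) : Set (Z → ℝ) :=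
  closedConvexHull ℝ {φ | ∃ u, IsCutFamily u ∧ φ = cutFun i₀ u}

/-- As `w` and `x` vary, `w + Pi.single i₀ (x - ∑ j, w j)` is uniform on `Z^κ` and has coordinate
sum `x`. The index `i₀` only selects the coordinate that absorbs the constraint. -/
theorem expect_mul_cutFun (i₀ : κ) (u : κ → (κ → Z) → ℝ) (g : Z → ℝ) :
    𝔼 x, g x * cutFun i₀ u x = 𝔼 z : κ → Z, g (∑ i, z i) * ∏ i, u i z := by
  set Ψ : (κ → Z) → ℝ := fun z => g (∑ i, z i) * ∏ i, u i z with hΨ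
  have h1 : 𝔼 x, g x * cutFun i₀ u x =
      𝔼 w : κ → Z, 𝔼 x, Ψ (w + Pi.single i₀ (x - ∑ j, w j)) := by
    rw [Finset.expect_comm]
    refine Finset.expect_congr rfl fun x _ => ?_
    rw [cutFun, Finset.mul_expect]
    refine Finset.expect_congr rfl fun w _ => ?_
    simp [hΨ, Finset.sum_add_distrib]
  have h2 (w : κ → Z) : 𝔼 x, Ψ (w + Pi.single i₀ (x - ∑ j, w j)) =
      𝔼 a, Ψ (w + Pi.single i₀ a) :=
    Fintype.expect_equiv (Equiv.subRight (∑ j, w j)) _ _ fun x => rfl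
  have h3 (a : Z) : 𝔼 w : κ → Z, Ψ (w + Pi.single i₀ a) = 𝔼 w, Ψ w :=
    Fintype.expect_equiv (Equiv.addRight (Pi.single i₀ a)) _ _ fun x => rfl
  rw [h1]
  simp only [h2]
  rw [Finset.expect_comm]
  simp only [h3, Fintype.expect_const]

/-- Put `g` at vertex `0` of a box and `u i` at the vertex with a single `1` in position `i`. That
vertex differs from `z` only in the coordinate `u i` ignores, so the box form is the wanted pairing,
and Gowers–Cauchy–Schwarz leaves only the norm of `g`. -/
theorem abs_expect_mul_cutFun_le (i₀ : κ) {u : κ → (κ → Z) → ℝ} (hu : IsCutFamily u)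
    {g : Z → ℝ} {c : ℝ} (hc : 0 ≤ c)
    (hg : cubeForm (fun _ : κ → Fin 2 => g) ≤ c ^ Fintype.card (κ → Fin 2)) :
    |𝔼 x, g x * cutFun i₀ u x| ≤ c := by
  have : Nonempty κ := ⟨i₀⟩
  let F : (κ → Fin 2) → (κ → Z) → ℝ := fun ω z =>
    (if ω = 0 then g (∑ i, z i) else 1) * ∏ i, if ω = Pi.single i 1 then u i z else 1
  have hne (i : κ) : (0 : κ → Fin 2) ≠ Pi.single i 1 := by
    intro h
    simpa using congrFun h i
  have hF : boxForm F = 𝔼 x, g x * cutFun i₀ u x := by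
    rw [expect_mul_cutFun, boxForm]
    refine Finset.expect_congr rfl fun z _ => ?_
    have (y : κ → Z) : ∏ ω, F ω (boxVertex ω z y) = g (∑ i, z i) * ∏ i, u i z := by
      simp only [F, Finset.prod_mul_distrib]
      congr 1
      · rw [Finset.prod_ite_eq' Finset.univ (0 : κ → Fin 2)
          (fun ω => g (∑ i, boxVertex ω z y i))]
        simp [boxVertex]
      · rw [Finset.prod_comm]
        refine Finset.prod_congr rfl fun i _ => ?_
        rw [Finset.prod_ite_eq' Finset.univ (Pi.single i 1 : κ → Fin 2)
          (fun ω => u i (boxVertex ω z y))]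
        simp only [Finset.mem_univ, if_true]
        rw [← hu.2 i z (y i)]
        congr 1
        funext j
        by_cases hj : j = i
        · subst hj; simp [boxVertex]
        · simp [boxVertex, hj]
    simp only [this, Fintype.expect_const]
  have h0 : F 0 = fun z => g (∑ i, z i) := by
    funext z
    simp [F, hne]
  have h1 (σ) (hσ : σ ≠ 0) (z) : |F σ z| ≤ 1 := by
    simp only [F, hσ, if_false, one_mul, Finset.abs_prod]
    refine Finset.prod_le_one (fun _ _ => abs_nonneg _) fun i _ => ?_
    split_ifs
    · exact hu.1 i z
    · simp
  have h2 (σ) (hσ : σ ≠ 0) : |boxForm fun _ : κ → Fin 2 => F σ| ≤ 1 := by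
    refine (Finset.abs_expect_le _ _).trans
      (Finset.expect_le Finset.univ_nonempty fun z _ => ?_)
    refine (Finset.abs_expect_le _ _).trans
      (Finset.expect_le Finset.univ_nonempty fun y _ => ?_)
    rw [Finset.abs_prod]
    exact Finset.prod_le_one (fun _ _ => abs_nonneg _) fun i _ => h1 σ hσ _
  refine le_of_pow_le_pow_left₀ (n := Fintype.card (κ → Fin 2)) Fintype.card_ne_zero hc ?_
  rw [← hF]
  refine (abs_boxForm_pow_le F).trans ?_
  rw [← Finset.mul_prod_erase _ _ (Finset.mem_univ 0), h0, boxForm_comp_sum fun _ => g,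
    abs_of_nonneg (cubeForm_const_nonneg _)]
  refine (mul_le_of_le_one_right (cubeForm_const_nonneg _) ?_).trans hg
  exact Finset.prod_le_one (fun _ _ => abs_nonneg _) fun σ hσ => h2 σ (Finset.ne_of_mem_erase hσ)

theorem convex_cutHull (i₀ : κ) : Convex ℝ (cutHull Z i₀) := convex_closedConvexHull

theorem isClosed_cutHull (i₀ : κ) : IsClosed (cutHull Z i₀) := isClosed_closedConvexHull

theorem cutFun_mem_cutHull (i₀ : κ) {u : κ → (κ → Z) → ℝ} (hu : IsCutFamily u) :
    cutFun i₀ u ∈ cutHull Z i₀ :=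
  subset_closedConvexHull ⟨u, hu, rfl⟩

theorem cutHull_subset {i₀ : κ} {S : Set (Z → ℝ)} (hc : Convex ℝ S) (hcl : IsClosed S)
    (h : ∀ u, IsCutFamily u → cutFun i₀ u ∈ S) : cutHull Z i₀ ⊆ S :=
  closedConvexHull_min (by rintro _ ⟨u, hu, rfl⟩; exact h u hu) hc hcl

theorem abs_expect_mul_le_of_mem_cutHull {i₀ : κ} {φ : Z → ℝ} (hφ : φ ∈ cutHull Z i₀)
    {g : Z → ℝ} {c : ℝ} (hc : 0 ≤ c)
    (hg : cubeForm (fun _ : κ → Fin 2 => g) ≤ c ^ Fintype.card (κ → Fin 2)) :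
    |𝔼 x, g x * φ x| ≤ c := by
  rw [abs_le]
  constructor
  · exact cutHull_subset (convex_halfSpace_ge (isLinearMap_expect_mul g) (-c))
      (isClosed_le continuous_const (continuous_expect_mul g))
      (fun u hu => (abs_le.1 (abs_expect_mul_cutFun_le i₀ hu hc hg)).1) hφ
  · exact cutHull_subset (convex_halfSpace_le (isLinearMap_expect_mul g) c)
      (isClosed_le (continuous_expect_mul g) continuous_const)
      (fun u hu => (abs_le.1 (abs_expect_mul_cutFun_le i₀ hu hc hg)).2) hφ

theorem cutHull_subset_Icc (i₀ : κ) : cutHull Z i₀ ⊆ Set.Icc (-1) 1 := by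
  refine cutHull_subset (convex_Icc _ _) isClosed_Icc fun u hu => ?_
  have (x : Z) : |cutFun i₀ u x| ≤ 1 := by
    refine (Finset.abs_expect_le _ _).trans
      (Finset.expect_le Finset.univ_nonempty fun y _ => ?_)
    rw [Finset.abs_prod]
    exact Finset.prod_le_one (fun _ _ => abs_nonneg _) fun i _ => hu.1 i _
  exact ⟨fun x => (abs_le.1 (this x)).1, fun x => (abs_le.1 (this x)).2⟩

theorem one_mem_cutHull (i₀ : κ) : (1 : Z → ℝ) ∈ cutHull Z i₀ := by
  have h := cutFun_mem_cutHull i₀ (u := fun _ (_ : κ → Z) => (1 : ℝ)) ⟨by simp, by simp⟩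
  convert h using 1
  funext x
  simp [cutFun]

theorem neg_mem_cutHull {i₀ : κ} {φ : Z → ℝ} (hφ : φ ∈ cutHull Z i₀) : -φ ∈ cutHull Z i₀ := by
  have : cutHull Z i₀ ⊆ Neg.neg ⁻¹' cutHull Z i₀ := by
    refine cutHull_subset ?_ ((isClosed_cutHull i₀).preimage continuous_neg) fun u hu => ?_
    · exact (convex_cutHull i₀).is_linear_preimage
        (f := fun φ : Z → ℝ => -φ) IsLinearMap.isLinearMap_neg
    · have h := cutFun_mem_cutHull i₀ (u := fun i z => if i = i₀ then - u i z else u i z)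
        ⟨fun i z => by dsimp only; split_ifs <;> simpa using hu.1 i z,
          fun i z a => by simp only [hu.2]⟩
      refine Set.mem_of_eq_of_mem (x := -cutFun i₀ u) (funext fun x => ?_) h
      simp only [Pi.neg_apply, cutFun]
      rw [← Finset.expect_neg_distrib]
      refine Finset.expect_congr rfl fun w _ => ?_
      rw [← Finset.mul_prod_erase Finset.univ _ (Finset.mem_univ i₀),
        ← Finset.mul_prod_erase Finset.univ (fun i => if i = i₀ then _ else _)
          (Finset.mem_univ i₀)]
      simp only [if_true, neg_mul]
      congr 2
      exact Finset.prod_congr rfl fun i hi => by simp [Finset.ne_of_mem_erase hi]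
  exact this hφ

/-- Two points of `Z^κ` over the same `x` differ by a vector of coordinate sum zero, parametrized
independently of `x`. For each such shift the translated second family still ignores the right
coordinates and merges with the first. -/
theorem cutFun_mul_cutFun (i₀ : κ) (u v : κ → (κ → Z) → ℝ) (x : Z) :
    cutFun i₀ u x * cutFun i₀ v x = 𝔼 w' : κ → Z,
      cutFun i₀ (fun i z => u i z * v i (z + (w' - Pi.single i₀ (∑ j, w' j)))) x := by
  simp only [cutFun]
  rw [Fintype.expect_mul_expect]
  conv_rhs => rw [Finset.expect_comm]
  refine Finset.expect_congr rfl fun w _ => ?_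
  symm
  refine Fintype.expect_equiv (Equiv.addLeft w) _ _ fun w' => ?_
  simp only [Finset.prod_mul_distrib, Equiv.coe_addLeft]
  congr 1
  refine Finset.prod_congr rfl fun i _ => ?_
  congr 1
  simp only [Pi.add_apply, Finset.sum_add_distrib, sub_add_eq_sub_sub, Pi.single_sub]
  abel

/-- Closure under products puts all powers of a test function in the class; this is what permits
polynomial approximation in the dense model argument. The generators are extended to the hull one
factor at a time. -/
theorem mul_mem_cutHull {i₀ : κ} {φ ψ : Z → ℝ} (hφ : φ ∈ cutHull Z i₀) (hψ : ψ ∈ cutHull Z i₀) :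
    φ * ψ ∈ cutHull Z i₀ := by
  have hlin (a : Z → ℝ) : IsLinearMap ℝ (fun φ : Z → ℝ => φ * a) :=
    ⟨fun x y => add_mul x y a, fun c x => smul_mul_assoc c x a⟩
  have hgen {u v : κ → (κ → Z) → ℝ} (hu : IsCutFamily u) (hv : IsCutFamily v) :
      cutFun i₀ u * cutFun i₀ v ∈ cutHull Z i₀ := by
    have h : cutFun i₀ u * cutFun i₀ v = fun x => 𝔼 w' : κ → Z,
        cutFun i₀ (fun i z => u i z * v i (z + (w' - Pi.single i₀ (∑ j, w' j)))) x :=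
      funext fun x => cutFun_mul_cutFun i₀ u v x
    rw [h]
    refine expect_mem_of_convex (convex_cutHull i₀) _ fun w' => cutFun_mem_cutHull i₀ ⟨?_, ?_⟩
    · intro i z
      rw [abs_mul]
      exact mul_le_one₀ (hu.1 i z) (abs_nonneg _) (hv.1 i _)
    · intro i z a
      dsimp only
      rw [hu.2, ← hv.2 i (z + _) (a + (w' - Pi.single i₀ (∑ j, w' j) : κ → Z) i)]
      congr 2
      funext j
      by_cases hj : j = i
      · subst hj; simp
      · simp [hj]
  have hleft {u : κ → (κ → Z) → ℝ} (hu : IsCutFamily u) : cutHull Z i₀ ⊆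
      (fun ψ => ψ * cutFun i₀ u) ⁻¹' cutHull Z i₀ :=
    cutHull_subset ((convex_cutHull i₀).is_linear_preimage (hlin _))
      ((isClosed_cutHull i₀).preimage (continuous_mul_const _)) fun v hv => hgen hv hu
  have hright : cutHull Z i₀ ⊆ (fun φ => φ * ψ) ⁻¹' cutHull Z i₀ :=
    cutHull_subset ((convex_cutHull i₀).is_linear_preimage (hlin _))
      ((isClosed_cutHull i₀).preimage (continuous_mul_const _)) fun u hu => by
        rw [Set.mem_preimage, mul_comm]
        exact hleft hu hψ
  exact hright hφ

theorem pow_mem_cutHull {i₀ : κ} {φ : Z → ℝ} (hφ : φ ∈ cutHull Z i₀) (n : ℕ) :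
    φ ^ n ∈ cutHull Z i₀ := by
  induction n with
  | zero => simpa using one_mem_cutHull i₀
  | succ n ih => exact pow_succ φ n ▸ mul_mem_cutHull ih hφ

/-- A vertex `ω ≠ 0` has some `ω i = 1`, and there the box vertex uses `y i` instead of `z i`. With
`y` fixed, grouping the factors by such an `i` gives a cut family; averaging over `y` recovers the
dual function. -/
theorem cubeDual_mem_cutHull (i₀ : κ) {g : (κ → Fin 2) → Z → ℝ} (hg : ∀ ω x, |g ω x| ≤ 1) :
    cubeDual g ∈ cutHull Z i₀ := by
  have hex (ω : κ → Fin 2) : ∃ i, ω ≠ 0 → ω i = 1 := by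
    by_cases h : ω = 0
    · exact ⟨i₀, fun h' => absurd h h'⟩
    · obtain ⟨i, hi⟩ := Function.ne_iff.1 h
      refine ⟨i, fun _ => ?_⟩
      simp only [Pi.zero_apply] at hi
      omega
  choose p hp using hex
  let u : (κ → Z) → κ → (κ → Z) → ℝ := fun y i z =>
    ∏ ω ∈ Finset.univ.erase 0 with p ω = i, g ω (∑ j, boxVertex ω z y j)
  have hu (y) : IsCutFamily (u y) := by
    constructor
    · intro i z
      rw [Finset.abs_prod]
      exact Finset.prod_le_one (fun _ _ => abs_nonneg _) fun ω _ => hg ω _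
    · intro i z a
      refine Finset.prod_congr rfl fun ω hω => ?_
      obtain ⟨h0, h1⟩ := Finset.mem_filter.1 hω
      have h2 : ω i = 1 := h1 ▸ hp ω (Finset.ne_of_mem_erase h0)
      congr 2
      funext j
      by_cases hj : j = i
      · subst hj; simp [boxVertex, h2]
      · simp [boxVertex, hj]
  have hmem := expect_mem_of_convex (convex_cutHull i₀) (fun y => cutFun i₀ (u y))
    fun y => cutFun_mem_cutHull i₀ (hu y)
  convert hmem using 1
  funext x
  simp only [cutFun]
  rw [Finset.expect_comm]
  have (w : κ → Z) : 𝔼 y : κ → Z, ∏ i, u y i (w + Pi.single i₀ (x - ∑ j, w j)) =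
      cubeDual g x := by
    symm
    refine Fintype.expect_equiv (Equiv.addLeft (w + Pi.single i₀ (x - ∑ j, w j))) _ _ fun h => ?_
    rw [Finset.prod_fiberwise]
    simp only [Equiv.coe_addLeft, sum_boxVertex_add]
    simp [Finset.sum_add_distrib]
  simp only [this, Fintype.expect_const]

end CutFunctions

/-! ### The dense model theorem by minimax and polynomial approximation. -/

section DenseModel

/-- Minimax: if every test function `φ ∈ C` admits some `h ∈ K` with `⟪f - h, φ⟫ ≤ ε`,
then a single `h ∈ K` works for all of `C`. -/
theorem exists_forall_expect_sub_mul_le {Z : Type*} [Fintype Z] {K C : Set (Z → ℝ)}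
    (hKne : K.Nonempty) (hK : Convex ℝ K) (hKc : IsCompact K)
    (hCne : C.Nonempty) (hC : Convex ℝ C) (hCc : IsCompact C) (f : Z → ℝ) (ε : ℝ)
    (h : ∀ φ ∈ C, ∃ h ∈ K, 𝔼 x, (f x - h x) * φ x ≤ ε) :
    ∃ h ∈ K, ∀ φ ∈ C, 𝔼 x, (f x - h x) * φ x ≤ ε := by
  have hcont : Continuous fun p : (Z → ℝ) × (Z → ℝ) => 𝔼 x, (f x - p.1 x) * p.2 x := by
    simp only [Fintype.expect_eq_sum_div_card]
    fun_prop
  have hl (h : Z → ℝ) : ConcaveOn ℝ C fun φ : Z → ℝ => 𝔼 x, (f x - h x) * φ x :=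
    ((isLinearMap_expect_mul fun x => f x - h x).mk').concaveOn hC
  have hr (φ : Z → ℝ) : ConvexOn ℝ K fun h : Z → ℝ => 𝔼 x, (f x - h x) * φ x := by
    refine ⟨hK, fun a _ b _ s t _ _ hst => le_of_eq ?_⟩
    simp only [smul_eq_mul, Finset.mul_expect, ← Finset.expect_add_distrib, Pi.add_apply,
      Pi.smul_apply]
    refine Finset.expect_congr rfl fun x _ => ?_
    obtain rfl : t = 1 - s := by linarith
    ring
  obtain ⟨h₀, hh₀, φ₀, hφ₀, hsad⟩ := Sion.exists_isSaddlePointOn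
    (f := fun h φ : Z → ℝ => 𝔼 x, (f x - h x) * φ x) hKne hK hKc
    (fun φ _ => (hcont.comp (by fun_prop : Continuous fun h : Z → ℝ =>
      (h, φ))).lowerSemicontinuous.lowerSemicontinuousOn _)
    (fun φ _ => (hr φ).quasiconvexOn) hC hCne hCc
    (fun h _ => (hcont.comp (by fun_prop : Continuous fun φ : Z → ℝ =>
      (h, φ))).upperSemicontinuous.upperSemicontinuousOn _)
    (fun h _ => (hl h).quasiconcaveOn)
  obtain ⟨h₁, hh₁, hle⟩ := h φ₀ hφ₀
  exact ⟨h₀, hh₀, fun φ hφ => (hsad h₁ hh₁ φ hφ).trans hle⟩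

/-- The dense model theorem relative to the cut functions: `K = [a, 1]^Z`. -/
theorem exists_dense_model {κ : Type*} [Fintype κ] [DecidableEq κ] (i₀ : κ) {a : ℝ} (ha : a ≤ 1)
    {ε : ℝ} (hε : 0 < ε) :
    ∃ δ > 0, ∀ (Z : Type*) [AddCommGroup Z] [Fintype Z] (ν f : Z → ℝ), (∀ x, 0 ≤ ν x) →
      cubeForm (fun (_ : κ → Fin 2) x => ν x - 1) ≤ δ ^ Fintype.card (κ → Fin 2) →
      (∀ x, a * ν x ≤ f x ∧ f x ≤ ν x) →
      ∃ h : Z → ℝ, (∀ x, h x ∈ Set.Icc a 1) ∧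
        ∀ φ ∈ cutHull Z i₀, |𝔼 x, (f x - h x) * φ x| ≤ ε := by
  -- `k t` is the maximum of `c * t` over `c ∈ [a, 1]`. The polynomial is fixed before `Z` appears,
  -- so that `δ` is uniform in the group.
  set k : ℝ → ℝ := fun t => max t (a * t) with hk
  obtain ⟨P, hP⟩ := exists_polynomial_near_of_continuousOn (-1) 1 k
    (by fun_prop) (ε / 8) (by positivity)
  set L : ℝ := ∑ j ∈ Finset.range (P.natDegree + 1), |P.coeff j| with hL
  have hL0 : 0 ≤ L := Finset.sum_nonneg fun _ _ => abs_nonneg _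
  -- Each monomial costs its coefficient times `δ`, at most `L * δ ≤ ε / 2` in all; the
  -- approximation error costs at most `3 * (ε / 8)`, because the mean of `ν + 1` is at most `3`.
  refine ⟨min 1 (ε / (2 * (L + 1))), by positivity, ?_⟩
  intro Z _ _ ν f hν hδ hf
  set δ := min 1 (ε / (2 * (L + 1))) with hδdef
  have hδ0 : 0 ≤ δ := by positivity
  have hδ1 : δ ≤ 1 := min_le_left _ _
  have hδ2 : L * δ ≤ ε / 2 := by
    have h1 : δ ≤ ε / (2 * (L + 1)) := min_le_right _ _
    rw [le_div_iff₀ (by positivity)] at h1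
    nlinarith
  have hpair {φ : Z → ℝ} (hφ : φ ∈ cutHull Z i₀) : |𝔼 x, (ν x - 1) * φ x| ≤ δ :=
    abs_expect_mul_le_of_mem_cutHull hφ hδ0 hδ
  have hEν : 𝔼 x, (ν x + 1) ≤ 3 := by
    have h1 := (abs_le.1 (hpair (one_mem_cutHull i₀))).2
    simp only [Pi.one_apply, mul_one, Finset.expect_sub_distrib, Fintype.expect_const] at h1
    rw [Finset.expect_add_distrib, Fintype.expect_const]
    linarith
  have hcompact : IsCompact (cutHull Z i₀) :=
    isCompact_Icc.of_isClosed_subset (isClosed_cutHull i₀) (cutHull_subset_Icc i₀)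
  obtain ⟨h, hh, hle⟩ := exists_forall_expect_sub_mul_le (K := Set.Icc (fun _ : Z => a) 1)
    ⟨1, fun _ => ha, le_rfl⟩ (convex_Icc _ _) isCompact_Icc ⟨1, one_mem_cutHull i₀⟩
    (convex_cutHull i₀) hcompact f ε (by
      intro φ hφ
      have hφ1 (x : Z) : φ x ∈ Set.Icc (-1 : ℝ) 1 :=
        ⟨(cutHull_subset_Icc i₀ hφ).1 x, (cutHull_subset_Icc i₀ hφ).2 x⟩
      -- This choice maximizes the pairing with `φ`: it gives `h * φ = k φ`, while `f * φ ≤ ν * k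
      -- φ`.
      refine ⟨fun x => if 0 ≤ φ x then 1 else a, ⟨fun x => ?_, fun x => ?_⟩, ?_⟩
      · dsimp only
        split_ifs <;> simp [ha]
      · dsimp only
        split_ifs <;> simp [ha]
      have hpoint (x : Z) : (f x - if 0 ≤ φ x then 1 else a) * φ x ≤
          (ν x - 1) * P.eval (φ x) + ε / 8 * (ν x + 1) := by
        have h1 : (f x - if 0 ≤ φ x then 1 else a) * φ x ≤ (ν x - 1) * k (φ x) := by
          split_ifs with h0
          · have : k (φ x) = φ x := max_eq_left (by nlinarith)
            rw [this]
            nlinarith [(hf x).2]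
          · have : k (φ x) = a * φ x := max_eq_right (by nlinarith)
            rw [this]
            nlinarith [(hf x).1]
        have h2 := abs_lt.1 (hP (φ x) (hφ1 x))
        have h3 : (ν x - 1) * (k (φ x) - P.eval (φ x)) ≤ (ν x + 1) * (ε / 8) := by
          refine (le_abs_self _).trans ?_
          rw [abs_mul]
          refine mul_le_mul ?_ ?_ (abs_nonneg _) (by linarith [hν x])
          · rw [abs_le]
            constructor <;> linarith [hν x]
          · rw [abs_le]
            constructor <;> linarith
        linarith
      have hpoly : 𝔼 x, (ν x - 1) * P.eval (φ x) ≤ L * δ := by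
        simp only [Polynomial.eval_eq_sum_range, Finset.mul_sum]
        rw [Finset.expect_sum_comm, hL, Finset.sum_mul]
        refine Finset.sum_le_sum fun j _ => ?_
        have h1 : 𝔼 x, (ν x - 1) * (P.coeff j * φ x ^ j) =
            P.coeff j * 𝔼 x, (ν x - 1) * (φ ^ j) x := by
          rw [Finset.mul_expect]
          exact Finset.expect_congr rfl fun x _ => by simp only [Pi.pow_apply]; ring
        rw [h1]
        refine (le_abs_self _).trans ?_
        rw [abs_mul]
        exact mul_le_mul_of_nonneg_left (hpair (pow_mem_cutHull hφ j)) (abs_nonneg _)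
      refine (Finset.expect_le_expect fun x _ => hpoint x).trans ?_
      rw [Finset.expect_add_distrib, ← Finset.mul_expect]
      nlinarith)
  refine ⟨h, fun x => ⟨hh.1 x, hh.2 x⟩, fun φ hφ => abs_le.2 ⟨?_, hle φ hφ⟩⟩
  have := hle _ (neg_mem_cutHull hφ)
  simp only [Pi.neg_apply, mul_neg, Finset.expect_neg_distrib] at this
  linarith

end DenseModel

/-! ### Densification: replacing unbounded entries by bounded ones. -/

section Replacement

variable {Z : Type*} [AddCommGroup Z] [Fintype Z] {ι : Type*} [Fintype ι] [DecidableEq ι]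

theorem glueFaces_eq_or {ν : Z → ℝ} {m m' : (ι → Fin 2) → Z → ℝ}
    (hm : ∀ ω, m ω = ν ∨ m ω = 1) (hm' : ∀ ω, m' ω = ν ∨ m' ω = 1) (ω : ι ⊕ ι → Fin 2) :
    glueFaces m m' ω = ν ∨ glueFaces m m' ω = 1 := by
  unfold glueFaces
  split_ifs
  · exact hm' _
  · exact hm _
  · exact Or.inr rfl

theorem abs_glueFaces_le {f f' m m' : (ι → Fin 2) → Z → ℝ} (h : ∀ ω x, |f ω x| ≤ m ω x)
    (h' : ∀ ω x, |f' ω x| ≤ m' ω x) (ω : ι ⊕ ι → Fin 2) (x : Z) :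
    |glueFaces f f' ω x| ≤ glueFaces m m' ω x := by
  unfold glueFaces
  split_ifs
  · exact h' _ _
  · exact h _ _
  · simp

theorem expect_mul_cubeDual_mul_cubeDual (w : Z → ℝ) (f f' : (ι → Fin 2) → Z → ℝ) :
    𝔼 x, w x * (cubeDual f x * cubeDual f' x) =
      cubeForm (Function.update (glueFaces f f') 0 w) := by
  simp only [cubeForm_update_zero, cubeDual_glueFaces]

/-- The number `2 ^ 2 ^ (2 * |ι|)` of subsets of the doubled cube. -/
def formCount (ι : Type*) [Fintype ι] [DecidableEq ι] : ℝ :=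
  2 ^ Fintype.card (ι ⊕ ι → Fin 2)

theorem formCount_pos : 0 < formCount ι := by unfold formCount; positivity

variable [Nonempty ι] {ν : Z → ℝ} {η : ℝ}

theorem abs_expect_mul_cubeDual_mul_cubeDual_sub_one_le (hη : 0 ≤ η) (hη1 : η ≤ 1)
    (hν : cubeForm (fun (_ : ι ⊕ ι → Fin 2) x => ν x - 1) ≤ η ^ Fintype.card (ι ⊕ ι → Fin 2))
    {w : Z → ℝ} (hw : w = ν ∨ w = 1) {m m' : (ι → Fin 2) → Z → ℝ}
    (hm : ∀ ω, m ω = ν ∨ m ω = 1) (hm' : ∀ ω, m' ω = ν ∨ m' ω = 1) :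
    |𝔼 x, w x * (cubeDual m x * cubeDual m' x) - 1| ≤ formCount ι * η := by
  rw [expect_mul_cubeDual_mul_cubeDual]
  refine abs_cubeForm_sub_one_le hη hη1 hν fun ω => ?_
  by_cases h : ω = 0
  · subst h; simpa using hw
  · rw [Function.update_of_ne h]
    exact glueFaces_eq_or hm hm' ω

/-- In the glued form `ν - 1` sits at vertex `0` and contributes a factor `η`. Every other entry is
dominated by `ν` or `1`, so its norm is bounded by the linear forms condition. -/
theorem abs_expect_sub_one_mul_cubeDual_mul_cubeDual_le (hη : 0 ≤ η) (hη1 : η ≤ 1)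
    (hν : cubeForm (fun (_ : ι ⊕ ι → Fin 2) x => ν x - 1) ≤ η ^ Fintype.card (ι ⊕ ι → Fin 2))
    {f f' m m' : (ι → Fin 2) → Z → ℝ} (hf : ∀ ω x, |f ω x| ≤ m ω x)
    (hf' : ∀ ω x, |f' ω x| ≤ m' ω x)
    (hm : ∀ ω, m ω = ν ∨ m ω = 1) (hm' : ∀ ω, m' ω = ν ∨ m' ω = 1) :
    |𝔼 x, (ν x - 1) * (cubeDual f x * cubeDual f' x)| ≤
      (1 + formCount ι) ^ Fintype.card (ι ⊕ ι → Fin 2) * η := by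
  have hK := formCount_pos (ι := ι)
  rw [expect_mul_cubeDual_mul_cubeDual (fun x => ν x - 1)]
  refine (abs_cubeForm_le _ (Function.update (fun _ => 1 + formCount ι) 0 η) ?_ ?_).trans ?_
  · intro ω
    by_cases h : ω = 0
    · subst h; simpa using hη
    · rw [Function.update_of_ne h]
      positivity
  · intro ω
    by_cases h : ω = 0
    · subst h; simpa using hν
    · simp only [Function.update_of_ne h]
      have h1 := abs_cubeForm_le_cubeForm (κ := ι ⊕ ι)
        (f := fun _ => glueFaces f f' ω) (m := fun _ => glueFaces m m' ω)
        fun _ => abs_glueFaces_le hf hf' ω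
      have h2 := abs_cubeForm_sub_one_le hη hη1 hν (m := fun _ => glueFaces m m' ω)
        fun _ => glueFaces_eq_or hm hm' ω
      have h3 : (2 : ℝ) ^ Fintype.card (ι ⊕ ι → Fin 2) * η ≤ formCount ι :=
        mul_le_of_le_one_right hK.le hη1
      have h4 : 1 + formCount ι ≤ (1 + formCount ι) ^ Fintype.card (ι ⊕ ι → Fin 2) :=
        le_self_pow₀ (by linarith) Fintype.card_ne_zero
      linarith [(abs_le.1 h2).2, (abs_le.1 h1).2]
  · rw [Finset.prod_update_of_mem (Finset.mem_univ _), Finset.prod_const, mul_comm]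
    refine mul_le_mul_of_nonneg_right (pow_le_pow_right₀ (by linarith) ?_) hη
    exact Finset.card_le_univ _

theorem sq_expect_mul_le_of_abs_le {w D : Z → ℝ} (hw : ∀ x, |w x| ≤ ν x) :
    (𝔼 x, w x * D x) ^ 2 ≤ (𝔼 x, ν x) * 𝔼 x, ν x * (D x * D x) := by
  have hν (x) : 0 ≤ ν x := (abs_nonneg _).trans (hw x)
  have h1 : |𝔼 x, w x * D x| ≤ 𝔼 x, √(ν x) * (√(ν x) * |D x|) := by
    refine (Finset.abs_expect_le _ _).trans (Finset.expect_le_expect fun x _ => ?_)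
    rw [← mul_assoc, Real.mul_self_sqrt (hν x), abs_mul]
    exact mul_le_mul_of_nonneg_right (hw x) (abs_nonneg _)
  rw [← sq_abs]
  refine (pow_le_pow_left₀ (abs_nonneg _) h1 2).trans
    ((Finset.expect_mul_sq_le_sq_mul_sq _ _ _).trans_eq ?_)
  congr 1
  · exact Finset.expect_congr rfl fun x _ => Real.sq_sqrt (hν x)
  · refine Finset.expect_congr rfl fun x _ => ?_
    rw [mul_pow, Real.sq_sqrt (hν x), sq_abs, sq]

/-- The truncation of a function to `[-1, 1]`. -/
noncomputable def unitTrunc (D : Z → ℝ) (x : Z) : ℝ := max (-1) (min 1 (D x))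

theorem abs_unitTrunc_le (D : Z → ℝ) (x : Z) : |unitTrunc D x| ≤ 1 :=
  abs_le.2 ⟨le_max_left _ _, max_le (by norm_num) (min_le_left _ _)⟩

theorem abs_sub_unitTrunc_le {D : Z → ℝ} {x : Z} {M : ℝ} (h : |D x| ≤ M) :
    |D x - unitTrunc D x| ≤ |M - 1| := by
  obtain ⟨h1, h2⟩ := abs_le.1 h
  unfold unitTrunc
  have := le_abs_self (M - 1)
  have := abs_nonneg (M - 1)
  rcases le_total 1 (D x) with h3 | h3
  · rw [min_eq_left h3, max_eq_right (by norm_num), abs_le]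
    constructor <;> linarith
  · rw [min_eq_right h3]
    rcases le_total (-1) (D x) with h4 | h4
    · simp [max_eq_right h4]
    · rw [max_eq_left h4, abs_le]
      constructor <;> linarith

/-- The constant in `sq_expect_mul_cubeDual_le`. -/
noncomputable def truncConst (ι : Type*) [Fintype ι] [DecidableEq ι] : ℝ :=
  (1 + formCount ι) ^ Fintype.card (ι ⊕ ι → Fin 2) + 3 * (1 + formCount ι)

/-- Cauchy–Schwarz with weight `ν` discards `w` and leaves the mean of `ν * D ^ 2`; the weight is
then replaced by `1`, and one factor `D` by its truncation. Truncation is cheap because `|D| ≤ M`,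
where `M` has first and second moments close to `1`. Thus the unbounded `w` is traded for the
bounded function `unitTrunc D`. -/
theorem sq_expect_mul_cubeDual_le (hη : 0 ≤ η) (hη1 : η ≤ 1)
    (hν : cubeForm (fun (_ : ι ⊕ ι → Fin 2) x => ν x - 1) ≤ η ^ Fintype.card (ι ⊕ ι → Fin 2))
    {w : Z → ℝ} (hw : ∀ x, |w x| ≤ ν x) {f m : (ι → Fin 2) → Z → ℝ}
    (hf : ∀ ω x, |f ω x| ≤ m ω x) (hm : ∀ ω, m ω = ν ∨ m ω = 1) :
    (𝔼 x, w x * cubeDual f x) ^ 2 ≤ (1 + formCount ι) *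
      (truncConst ι * √η + |𝔼 x, unitTrunc (cubeDual f) x * cubeDual f x|) := by
  set K := formCount ι with hKdef
  have hK : 0 < K := formCount_pos
  set D := cubeDual f with hD
  set M := cubeDual m with hM
  have hDM (x) : |D x| ≤ M x := abs_cubeDual_le_cubeDual hf x
  have hKη : K * η ≤ K := mul_le_of_le_one_right hK.le hη1
  have hone (ω : ι → Fin 2) : (fun _ : ι → Fin 2 => (1 : Z → ℝ)) ω = ν ∨
      (fun _ : ι → Fin 2 => (1 : Z → ℝ)) ω = 1 := Or.inr rfl
  have hEν : 𝔼 x, ν x ≤ 1 + K := by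
    have := abs_expect_mul_cubeDual_mul_cubeDual_sub_one_le hη hη1 hν (Or.inl rfl) hone hone
    simp only [cubeDual_one, Pi.one_apply, mul_one] at this
    linarith [(abs_le.1 this).2]
  have hEM : |𝔼 x, M x - 1| ≤ K * η := by
    have := abs_expect_mul_cubeDual_mul_cubeDual_sub_one_le hη hη1 hν (Or.inr rfl) hm hone
    simpa only [cubeDual_one, Pi.one_apply, mul_one, one_mul] using this
  have hEMM : |𝔼 x, M x * M x - 1| ≤ K * η := by
    have := abs_expect_mul_cubeDual_mul_cubeDual_sub_one_le hη hη1 hν (Or.inr rfl) hm hm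
    simpa only [Pi.one_apply, one_mul] using this
  have hM1 : 𝔼 x, |M x - 1| ^ 2 ≤ 3 * (K * η) := by
    have : 𝔼 x, |M x - 1| ^ 2 = 𝔼 x, M x * M x - 2 * 𝔼 x, M x + 1 := by
      have h1 : (1 : ℝ) = 𝔼 _x : Z, (1 : ℝ) := (Fintype.expect_const _).symm
      rw [Finset.mul_expect, h1, ← Finset.expect_sub_distrib, ← Finset.expect_add_distrib, ← h1]
      refine Finset.expect_congr rfl fun x _ => ?_
      rw [sq_abs]
      ring
    linarith [(abs_le.1 hEM).1, (abs_le.1 hEMM).2]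
  -- This bounds the truncation error by Cauchy–Schwarz from the variance estimate `hM1`; it is the
  -- source of the square root of `η`.
  have herr : 𝔼 x, |M x - 1| * M x ≤ 3 * (1 + K) * √η := by
    refine le_of_sq_le_sq ?_ (by positivity)
    refine (Finset.expect_mul_sq_le_sq_mul_sq _ _ _).trans ?_
    have h1 : 𝔼 x, M x ^ 2 ≤ 1 + K := by
      simp only [sq]
      linarith [(abs_le.1 hEMM).2]
    rw [mul_pow, Real.sq_sqrt hη]
    refine (mul_le_mul hM1 h1 (Finset.expect_nonneg fun _ _ => sq_nonneg _)
      (by positivity)).trans ?_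
    have : 0 ≤ η * (1 + K) := by positivity
    nlinarith
  have hDD : 𝔼 x, D x * D x ≤ |𝔼 x, unitTrunc D x * D x| + 3 * (1 + K) * √η := by
    have h1 : 𝔼 x, D x * D x ≤ 𝔼 x, unitTrunc D x * D x + 𝔼 x, |M x - 1| * M x := by
      rw [← Finset.expect_add_distrib]
      refine Finset.expect_le_expect fun x _ => ?_
      have h2 : (D x - unitTrunc D x) * D x ≤ |M x - 1| * M x := by
        refine (le_abs_self _).trans ?_
        rw [abs_mul]
        exact mul_le_mul (abs_sub_unitTrunc_le (hDM x)) (hDM x) (abs_nonneg _) (abs_nonneg _)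
      linarith
    linarith [le_abs_self (𝔼 x, unitTrunc D x * D x)]
  have hνDD : 𝔼 x, ν x * (D x * D x) ≤
      truncConst ι * √η + |𝔼 x, unitTrunc D x * D x| := by
    have h1 : 𝔼 x, ν x * (D x * D x) = 𝔼 x, (ν x - 1) * (D x * D x) + 𝔼 x, D x * D x := by
      rw [← Finset.expect_add_distrib]
      exact Finset.expect_congr rfl fun x _ => by ring
    have h2 := (abs_le.1
      (abs_expect_sub_one_mul_cubeDual_mul_cubeDual_le hη hη1 hν hf hf hm hm)).2
    have h3 : η ≤ √η := Real.le_sqrt_of_sq_le (by nlinarith)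
    have h4 := mul_le_mul_of_nonneg_left h3
      (by positivity : 0 ≤ (1 + formCount ι) ^ Fintype.card (ι ⊕ ι → Fin 2))
    rw [truncConst, h1, add_mul]
    linarith
  refine (sq_expect_mul_le_of_abs_le hw).trans ?_
  refine mul_le_mul hEν hνDD ?_ (by positivity)
  exact Finset.expect_nonneg fun x _ =>
    mul_nonneg ((abs_nonneg _).trans (hw x)) (mul_self_nonneg _)

end Replacement

/-- If `f₀` is bounded by a pseudorandom weight `ν` and has small correlation with the dual
functions of bounded families, then it has small correlation with the dual functions of families
bounded by `ν` at the vertices in `T`. -/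
theorem exists_abs_expect_mul_cubeDual_le {ι : Type*} [Fintype ι] [DecidableEq ι] [Nonempty ι]
    (T : Finset (ι → Fin 2)) (hT : 0 ∉ T) : ∀ ε > 0, ∃ δ > 0, δ ≤ 1 ∧
      ∀ (Z : Type*) [AddCommGroup Z] [Fintype Z] (ν f₀ : Z → ℝ),
        cubeForm (fun (_ : ι ⊕ ι → Fin 2) x => ν x - 1) ≤ δ ^ Fintype.card (ι ⊕ ι → Fin 2) →
        (∀ x, |f₀ x| ≤ ν x) →
        (∀ g : (ι → Fin 2) → Z → ℝ, (∀ ω x, |g ω x| ≤ 1) →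
          |𝔼 x, f₀ x * cubeDual g x| ≤ δ) →
        ∀ f : (ι → Fin 2) → Z → ℝ, (∀ ω ∈ T, ∀ x, |f ω x| ≤ ν x) →
          (∀ ω ∉ T, ∀ x, |f ω x| ≤ 1) → |𝔼 x, f₀ x * cubeDual f x| ≤ ε := by
  induction T using Finset.induction_on with
  | empty =>
    intro ε hε
    refine ⟨min ε 1, by positivity, min_le_right _ _, ?_⟩
    intro Z _ _ ν f₀ _ _ hg f _ hf
    exact (hg f fun ω => hf ω (Finset.notMem_empty _)).trans (min_le_left _ _)
  | insert ω₀ T hω₀ ih =>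
    intro ε hε
    have hT0 : (0 : ι → Fin 2) ∉ T := fun h => hT (Finset.mem_insert_of_mem h)
    have hne : ω₀ ≠ 0 := fun h => hT (h ▸ Finset.mem_insert_self _ _)
    have hK := formCount_pos (ι := ι)
    set A := 1 + formCount ι with hA
    have hA0 : 0 < A := by positivity
    set B := truncConst ι with hB
    have hB0 : 0 < B := by rw [hB, truncConst]; positivity
    obtain ⟨δ₁, hδ₁, hδ₁1, H⟩ := ih hT0 (ε ^ 2 / (2 * A)) (by positivity)
    -- With this threshold `A * B * √δ ≤ ε ^ 2 / 2`; the other half of `ε ^ 2` comes from the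
    -- inductive bound.
    refine ⟨min δ₁ ((ε ^ 2 / (2 * A * B)) ^ 2), by positivity,
      (min_le_left _ _).trans hδ₁1, ?_⟩
    set δ := min δ₁ ((ε ^ 2 / (2 * A * B)) ^ 2) with hδdef
    have hδ0 : 0 ≤ δ := by positivity
    have hδle : δ ≤ δ₁ := min_le_left _ _
    intro Z _ _ ν f₀ hν hf₀ hg f hfT hf1
    -- Put `f₀` at vertex `0` and take `ω₀` as the new base point. Then `f ω₀` is paired with the
    -- dual function of `F'` and can be removed by Cauchy–Schwarz.
    set F : (ι → Fin 2) → Z → ℝ := Function.update f 0 f₀ with hF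
    set F' : (ι → Fin 2) → Z → ℝ := fun τ => F (ω₀ + τ) with hF'
    have hself : ω₀ + ω₀ = 0 := by
      funext i
      simp only [Pi.add_apply, Pi.zero_apply]
      omega
    have hF'0 : F' 0 = f ω₀ := by simp [hF', hF, Function.update_of_ne hne]
    have h1 : 𝔼 x, f₀ x * cubeDual f x = 𝔼 x, f ω₀ x * cubeDual F' x := by
      rw [← cubeForm_update_zero, ← cubeForm_add_left _ ω₀, cubeForm_eq_expect_cubeDual]
      change 𝔼 x, F' 0 x * cubeDual F' x = _
      rw [hF'0]
    have h2 (g : Z → ℝ) : 𝔼 x, g x * cubeDual F' x =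
        𝔼 x, f₀ x * cubeDual (Function.update f ω₀ g) x := by
      rw [← cubeForm_update_zero, ← cubeForm_update_zero, ← cubeForm_add_left _ ω₀]
      congr 1
      funext τ
      by_cases h : τ = ω₀
      · subst h
        rw [hself, Function.update_of_ne hne]
        simp
      · have hFF : F' (ω₀ + τ) = F τ := by
          simp only [hF']
          rw [← add_assoc, hself, zero_add]
        have h0 : ω₀ + τ ≠ 0 := by
          intro h'
          apply h
          have : ω₀ + (ω₀ + τ) = ω₀ + 0 := by rw [h']
          rwa [← add_assoc, hself, zero_add, add_zero] at this
        rw [Function.update_of_ne h0, hFF, hF]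
        by_cases hτ : τ = 0
        · subst hτ; simp
        · rw [Function.update_of_ne hτ, Function.update_of_ne hτ, Function.update_of_ne h]
    have hmaj (τ : ι → Fin 2) : ∃ m : Z → ℝ, (m = ν ∨ m = 1) ∧ ∀ x, |F' τ x| ≤ m x := by
      by_cases h0 : ω₀ + τ = 0
      · refine ⟨ν, Or.inl rfl, fun x => ?_⟩
        simpa [hF', hF, h0] using hf₀ x
      · simp only [hF', hF, Function.update_of_ne h0]
        by_cases hT' : ω₀ + τ ∈ insert ω₀ T
        · exact ⟨ν, Or.inl rfl, hfT _ hT'⟩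
        · exact ⟨1, Or.inr rfl, hf1 _ hT'⟩
    choose m hm hFm using hmaj
    have h3 := sq_expect_mul_cubeDual_le hδ0 (hδle.trans hδ₁1) hν
      (hfT ω₀ (Finset.mem_insert_self _ _)) hFm hm
    -- Rebasing back to `0` shows the original correlation with the entry at `ω₀` now bounded by
    -- `1`, so only the vertices in `T` remain unbounded and the induction hypothesis applies.
    have h4 : |𝔼 x, unitTrunc (cubeDual F') x * cubeDual F' x| ≤ ε ^ 2 / (2 * A) := by
      rw [h2]
      refine H Z ν f₀ (hν.trans (pow_le_pow_left₀ hδ0 hδle _)) hf₀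
        (fun g hg' => (hg g hg').trans hδle) _ ?_ ?_
      · intro ω hω
        have : ω ≠ ω₀ := fun h => hω₀ (h ▸ hω)
        rw [Function.update_of_ne this]
        exact hfT ω (Finset.mem_insert_of_mem hω)
      · intro ω hω
        by_cases h : ω = ω₀
        · subst h
          simpa using abs_unitTrunc_le (cubeDual F')
        · rw [Function.update_of_ne h]
          exact hf1 ω (by simp [h, hω])
    have h5 : √δ ≤ ε ^ 2 / (2 * A * B) :=
      Real.sqrt_le_iff.2 ⟨by positivity, min_le_right _ _⟩
    rw [h1]
    refine abs_le_of_sq_le_sq (h3.trans ?_) hε.le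
    calc A * (B * √δ + |𝔼 x, unitTrunc (cubeDual F') x * cubeDual F' x|)
        ≤ A * (B * (ε ^ 2 / (2 * A * B)) + ε ^ 2 / (2 * A)) := by gcongr
      _ = ε ^ 2 := by field_simp; ring

/-! ### Return to Gowers norms and construction of the rate. -/

section Gowers

theorem cubeForm_const_congr {Z : Type*} [AddCommGroup Z] [Fintype Z] {κ κ' : Type*} [Fintype κ]
    [DecidableEq κ] [Fintype κ'] [DecidableEq κ'] (e : κ ≃ κ') (g : Z → ℝ) :
    cubeForm (fun _ : κ → Fin 2 => g) = cubeForm (fun _ : κ' → Fin 2 => g) := by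
  refine Finset.expect_congr rfl fun x _ => ?_
  refine Fintype.expect_equiv (e.arrowCongr (Equiv.refl Z)) _ _ fun h => ?_
  refine Fintype.prod_equiv (e.arrowCongr (Equiv.refl (Fin 2))) _ _ fun ω => ?_
  refine congrArg (fun t => g (x + t)) (Fintype.sum_equiv e _ _ fun i => ?_)
  simp [Equiv.arrowCongr]

theorem gowersNorm_eq {Z : Type*} [AddCommGroup Z] [Fintype Z] (n : ℕ) (f : Z → ℝ) :
    gowersNorm n f = cubeForm (fun _ : Fin n → Fin 2 => f) ^ ((1 : ℝ) / 2 ^ n) := by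
  rw [gowersNorm, cubeForm, ← Finset.univ_product_univ, Finset.expect_product]
  rfl

theorem gowersNorm_le_iff {Z : Type*} [AddCommGroup Z] [Fintype Z] {n : ℕ} (hn : n ≠ 0)
    (f : Z → ℝ) {c : ℝ} (hc : 0 ≤ c) :
    gowersNorm n f ≤ c ↔ cubeForm (fun _ : Fin n → Fin 2 => f) ≤
      c ^ Fintype.card (Fin n → Fin 2) := by
  have : Nonempty (Fin n) := ⟨⟨0, Nat.pos_of_ne_zero hn⟩⟩
  have h := Real.rpow_inv_le_iff_of_pos (z := (2 : ℝ) ^ n)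
    (cubeForm_const_nonneg (κ := Fin n) f) hc (by positivity)
  rw [gowersNorm_eq, one_div, h]
  have h2 : c ^ ((2 : ℝ) ^ n) = c ^ Fintype.card (Fin n → Fin 2) := by
    rw [← Real.rpow_natCast c]
    congr 1
    simp
  rw [h2]

theorem gowersNorm_two_mul_le_iff {Z : Type*} [AddCommGroup Z] [Fintype Z] {s : ℕ} (hs : s ≠ 0)
    (f : Z → ℝ) {c : ℝ} (hc : 0 ≤ c) :
    gowersNorm (2 * s) f ≤ c ↔ cubeForm (fun _ : Fin s ⊕ Fin s → Fin 2 => f) ≤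
      c ^ Fintype.card (Fin s ⊕ Fin s → Fin 2) := by
  have e : Fin s ⊕ Fin s ≃ Fin (2 * s) := finSumFinEquiv.trans (finCongr (by omega))
  rw [gowersNorm_le_iff (by omega) f hc, cubeForm_const_congr e,
    Fintype.card_congr (e.arrowCongr (Equiv.refl (Fin 2)))]

/-- Functions bounded by a pseudorandom weight have bounded Gowers norm. -/
theorem gowersNorm_le_of_abs_le {s : ℕ} (hs : s ≠ 0) {Z : Type*} [AddCommGroup Z] [Fintype Z]
    {ν f : Z → ℝ} {η : ℝ} (hη : 0 ≤ η) (hη1 : η ≤ 1)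
    (hν : gowersNorm (2 * s) (fun x => ν x - 1) ≤ η) (hf : ∀ x, |f x| ≤ ν x) :
    gowersNorm s f ≤ 1 + formCount (Fin s) := by
  have : Nonempty (Fin s) := ⟨⟨0, Nat.pos_of_ne_zero hs⟩⟩
  have hK := formCount_pos (ι := Fin s)
  rw [gowersNorm_two_mul_le_iff hs _ hη] at hν
  rw [gowersNorm_le_iff hs f (by positivity)]
  have h1 := abs_cubeForm_le_cubeForm (κ := Fin s) (f := fun _ => f) (m := fun _ => ν) fun _ => hf
  have h2 := abs_expect_mul_cubeDual_mul_cubeDual_sub_one_le hη hη1 hν (Or.inl rfl)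
    (m := fun _ => ν) (m' := fun _ => 1) (fun _ => Or.inl rfl) (fun _ => Or.inr rfl)
  simp only [cubeDual_one, Pi.one_apply, mul_one] at h2
  rw [← cubeForm_eq_expect_cubeDual (fun _ => ν)] at h2
  have h3 : formCount (Fin s) * η ≤ formCount (Fin s) := mul_le_of_le_one_right hK.le hη1
  have h4 : 1 + formCount (Fin s) ≤ (1 + formCount (Fin s)) ^ Fintype.card (Fin s → Fin 2) :=
    le_self_pow₀ (by linarith) Fintype.card_ne_zero
  linarith [(abs_le.1 h2).2, (abs_le.1 h1).2]

/-- Gluing on a face of constants `1` regards an `s`-dimensional dual function as a `2s`-dimensional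
one, so it is a test function for the class controlled by the `U^{2s}` hypothesis. -/
theorem cubeDual_mem_cutHull_sum {ι : Type*} [Fintype ι] [DecidableEq ι] {Z : Type*}
    [AddCommGroup Z] [Fintype Z] (i₀ : ι ⊕ ι) {g : (ι → Fin 2) → Z → ℝ}
    (hg : ∀ ω x, |g ω x| ≤ 1) : cubeDual g ∈ cutHull Z i₀ := by
  have h : cubeDual g = cubeDual (glueFaces g fun _ => 1) := by
    funext x
    simp [cubeDual_glueFaces, cubeDual_one]
  rw [h]
  refine cubeDual_mem_cutHull i₀ fun ω x => ?_
  unfold glueFaces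
  split_ifs
  · simp
  · exact hg _ _
  · simp

/-- The dense model theorem in the Gowers norm. -/
theorem exists_gowersNorm_sub_le {s : ℕ} (hs : s ≠ 0) {ε : ℝ} (hε : 0 < ε) :
    ∃ δ > 0, ∀ (Z : Type*) [AddCommGroup Z] [Fintype Z] (ν : Z → ℝ), (∀ x, 0 ≤ ν x) →
      gowersNorm (2 * s) (fun x => ν x - 1) ≤ δ → ∀ f : Z → ℝ, (∀ x, |f x| ≤ ν x) →
        ∃ h : Z → ℝ, (∀ x, h x ∈ Set.Icc (-1 : ℝ) 1) ∧
          gowersNorm s (fun x => f x - h x) ≤ ε ∧ ((∀ x, 0 ≤ f x) → ∀ x, 0 ≤ h x) := by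
  have : Nonempty (Fin s) := ⟨⟨0, Nat.pos_of_ne_zero hs⟩⟩
  let i₀ : Fin s ⊕ Fin s := Sum.inl ⟨0, Nat.pos_of_ne_zero hs⟩
  -- The replacement is applied to half of `f - h`, whence `ε / 2` here and the tolerance `2 * δ₁`
  -- for the dense models.
  obtain ⟨δ₁, hδ₁, hδ₁1, H₁⟩ := exists_abs_expect_mul_cubeDual_le (ι := Fin s)
    (Finset.univ.erase 0) (Finset.notMem_erase _ _)
    ((ε / 2) ^ Fintype.card (Fin s → Fin 2)) (by positivity)
  obtain ⟨δ₂, hδ₂, H₂⟩ := exists_dense_model i₀ (a := -1) (by norm_num)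
    (ε := 2 * δ₁) (by positivity)
  obtain ⟨δ₃, hδ₃, H₃⟩ := exists_dense_model i₀ (a := 0) (by norm_num)
    (ε := 2 * δ₁) (by positivity)
  refine ⟨min δ₁ (min δ₂ δ₃), by positivity, ?_⟩
  set δ := min δ₁ (min δ₂ δ₃) with hδ
  have hδ0 : 0 ≤ δ := by positivity
  intro Z _ _ ν hν hδν f hf
  rw [gowersNorm_two_mul_le_iff hs _ hδ0] at hδν
  have hmodel : ∃ h : Z → ℝ, (∀ x, h x ∈ Set.Icc (-1 : ℝ) 1) ∧
      ((∀ x, 0 ≤ f x) → ∀ x, 0 ≤ h x) ∧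
      ∀ φ ∈ cutHull Z i₀, |𝔼 x, (f x - h x) * φ x| ≤ 2 * δ₁ := by
    by_cases hpos : ∀ x, 0 ≤ f x
    · obtain ⟨h, hh, hφ⟩ := H₃ Z ν f hν (hδν.trans (pow_le_pow_left₀ hδ0
        ((min_le_right _ _).trans (min_le_right _ _)) _))
        fun x => ⟨by simpa using hpos x, (abs_le.1 (hf x)).2⟩
      exact ⟨h, fun x => ⟨by linarith [(hh x).1], (hh x).2⟩, fun _ x => (hh x).1, hφ⟩
    · obtain ⟨h, hh, hφ⟩ := H₂ Z ν f hν (hδν.trans (pow_le_pow_left₀ hδ0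
        ((min_le_right _ _).trans (min_le_left _ _)) _))
        fun x => ⟨by simpa using (abs_le.1 (hf x)).1, (abs_le.1 (hf x)).2⟩
      exact ⟨h, hh, fun h' => absurd h' hpos, hφ⟩
  obtain ⟨h, hh, hpos, hφ⟩ := hmodel
  refine ⟨h, hh, ?_, hpos⟩
  -- Halving gives the majorant `(ν + 1) / 2`, whose deviation from `1` is half that of `ν`, so it
  -- is again pseudorandom.
  set f' : Z → ℝ := fun x => (1 / 2) * (f x - h x) with hf'
  have hν' : cubeForm (fun (_ : Fin s ⊕ Fin s → Fin 2) x => (1 / 2) * (ν x + 1) - 1) ≤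
      δ₁ ^ Fintype.card (Fin s ⊕ Fin s → Fin 2) := by
    have h1 : (fun x => (1 / 2) * (ν x + 1) - 1) = fun x => (1 / 2) * (ν x - 1) := by
      funext x
      ring
    rw [h1, cubeForm_const_smul]
    refine (mul_le_of_le_one_left (cubeForm_const_nonneg _)
      (pow_le_one₀ (by norm_num) (by norm_num))).trans (hδν.trans ?_)
    exact pow_le_pow_left₀ hδ0 (min_le_left _ _) _
  -- All vertices except `0` carry `f'`. The dual function ignores vertex `0`, which receives `1`
  -- only to meet the boundedness requirement; the correlation is then the full Gowers form of `f'`.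
  have key := H₁ Z (fun x => (1 / 2) * (ν x + 1)) f' hν' (fun x => by
      have h1 := abs_le.1 (hf x)
      have h2 := hh x
      rw [abs_le]
      constructor <;> simp only [hf'] <;> linarith [h2.1, h2.2]) (fun g hg => by
      have h1 := hφ _ (cubeDual_mem_cutHull_sum i₀ hg)
      have h2 : 𝔼 x, f' x * cubeDual g x = (1 / 2) * 𝔼 x, (f x - h x) * cubeDual g x := by
        rw [Finset.mul_expect]
        exact Finset.expect_congr rfl fun x _ => by simp only [hf']; ring
      rw [h2, abs_mul, abs_of_nonneg (by norm_num : (0 : ℝ) ≤ 1 / 2)]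
      linarith) (Function.update (fun _ => f') 0 1) (fun ω hω x => by
      rw [Function.update_of_ne (Finset.ne_of_mem_erase hω)]
      have h1 := abs_le.1 (hf x)
      have h2 := hh x
      rw [abs_le]
      constructor <;> simp only [hf'] <;> linarith [h2.1, h2.2]) (fun ω hω x => by
      have : ω = 0 := by simpa using hω
      subst this
      simp)
  rw [cubeDual_update_zero, ← cubeForm_eq_expect_cubeDual (fun _ => f'), hf',
    cubeForm_const_smul] at key
  rw [gowersNorm_le_iff hs _ hε.le]
  have h1 := (abs_le.1 key).2
  rw [div_pow, div_pow, one_pow] at h1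
  have h2 : (0 : ℝ) < 2 ^ Fintype.card (Fin s → Fin 2) := by positivity
  rw [one_div_mul_eq_div, div_le_div_iff_of_pos_right h2] at h1
  exact h1

/-- A family of estimates that hold for arbitrarily small errors yields a rate function. -/
theorem exists_tendsto_rate (P : ℝ → ℝ → Prop) {B : ℝ} (hB : 0 < B)
    (h₁ : ∀ η, 0 < η → η ≤ 1 → P η B)
    (h₂ : ∀ ε > 0, ∃ δ > 0, ∀ η, 0 < η → η ≤ δ → P η ε) :
    ∃ F : ℝ → ℝ, Tendsto F (𝓝[>] 0) (𝓝 0) ∧ ∀ η, 0 < η → η ≤ 1 → ∃ ε ≤ F η, P η ε := by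
  let S : ℝ → Set ℝ := fun η => {ε | 0 < ε ∧ P η ε}
  have hbdd (η) : BddBelow (S η) := ⟨0, fun ε hε => hε.1.le⟩
  -- The infimum need not be attained; adding `η` leaves room for an admissible `ε` below the rate
  -- without spoiling the limit.
  refine ⟨fun η => sInf (S η) + η, ?_, fun η h0 h1 => ?_⟩
  · have hid : Tendsto (fun η : ℝ => η) (𝓝[>] 0) (𝓝 0) := tendsto_id.mono_left nhdsWithin_le_nhds
    have hS : Tendsto (fun η => sInf (S η)) (𝓝[>] 0) (𝓝 0) := by
      refine tendsto_order.2 ⟨fun a ha => Eventually.of_forall fun η =>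
        ha.trans_le (Real.sInf_nonneg fun ε hε => hε.1.le), fun a ha => ?_⟩
      obtain ⟨δ, hδ, H⟩ := h₂ (a / 2) (by positivity)
      filter_upwards [Ioc_mem_nhdsGT hδ] with η hη
      have : sInf (S η) ≤ a / 2 := csInf_le (hbdd η) ⟨by positivity, H η hη.1 hη.2⟩
      linarith
    simpa using hS.add hid
  · obtain ⟨ε, hε, hlt⟩ := exists_lt_of_csInf_lt (s := S η) ⟨B, hB, h₁ η h0 h1⟩
      (lt_add_of_pos_right (sInf (S η)) h0)
    exact ⟨ε, hlt.le, hε.2⟩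

end Gowers

theorem corollary4p4 (s : ℕ) (hs : 2 ≤ s) :
    ∃ F : ℝ → ℝ, Tendsto F (𝓝[>] 0) (𝓝 0) ∧
      ∀ (Z : Type*) [AddCommGroup Z] [Fintype Z] (η : ℝ), 0 < η → η ≤ 1 →
        ∀ ν : Z → ℝ, (∀ x, 0 ≤ ν x) → gowersNorm (2 * s) (fun x => ν x - 1) ≤ η →
          ∀ f : Z → ℝ, (∀ x, |f x| ≤ ν x) →
            ∃ h : Z → ℝ, (∀ x, h x ∈ Set.Icc (-1 : ℝ) 1) ∧
              gowersNorm s (fun x => f x - h x) ≤ F η ∧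
              ((∀ x, 0 ≤ f x) → ∀ x, 0 ≤ h x) := by
  have hs0 : s ≠ 0 := by omega
  obtain ⟨F, hF, H⟩ := exists_tendsto_rate
    (fun η ε => ∀ (Z : Type _) [AddCommGroup Z] [Fintype Z],
      ∀ ν : Z → ℝ, (∀ x, 0 ≤ ν x) → gowersNorm (2 * s) (fun x => ν x - 1) ≤ η →
        ∀ f : Z → ℝ, (∀ x, |f x| ≤ ν x) →
          ∃ h : Z → ℝ, (∀ x, h x ∈ Set.Icc (-1 : ℝ) 1) ∧
            gowersNorm s (fun x => f x - h x) ≤ ε ∧ ((∀ x, 0 ≤ f x) → ∀ x, 0 ≤ h x))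
    (B := 1 + formCount (Fin s)) (by linarith [formCount_pos (ι := Fin s)])
    -- For `η` not small the model `h = 0` suffices, with the crude bound on the norm of `f` itself.
    (fun η h0 h1 Z _ _ ν _ hνη f hf => ⟨0, fun x => by simp, by
      simpa using gowersNorm_le_of_abs_le hs0 h0.le h1 hνη hf, fun _ x => le_rfl⟩)
    (fun ε hε => by
      obtain ⟨δ, hδ, H⟩ := exists_gowersNorm_sub_le hs0 hε
      exact ⟨δ, hδ, fun η _ hη Z _ _ ν hν hνη => H Z ν hν (hνη.trans hη)⟩)
  refine ⟨F, hF, fun Z _ _ η h0 h1 ν hν hνη f hf => ?_⟩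
  obtain ⟨ε, hε, hP⟩ := H η h0 h1
  obtain ⟨h, hh, hle, hpos⟩ := hP Z ν hν hνη f hf
  exact ⟨h, hh, hle.trans hε, hpos⟩
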